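/- Identify each subset of $\omega$ with its characteristic function, so that a filter on $\omega$ is a subset of $2^{\omega}$. All filters are proper and nonprincipal, i.e. they do not contain $\emptyset$ and contain every cofinite subset of $\omega$. For a sequence $\hat p = (p_n)_{n\in\omega}$ with $p_n \in (0,\tfrac12]$ let $\mu_{\hat p}$ be the product measure on $2^{\omega}$ with $\mu_{\hat p}(\{x : x(n)=1\}) = p_n$ and $\mu_{\hat p}(\{x : x(n)=0\}) = 1-p_n$ for all $n$; Lebesgue measure on $2^\omega$ is the case where $p_n = \tfrac12$ for all $n$. A set is $\mu_{\hat p}$-nonmeasurable if it is not measurable with respect to the completion of $\mu_{\hat p}$. Assume Martin's Axiom. Let $\hat p$ be a sequence in $(0,\tfrac12]$ with $\lim_{n\to\infty} p_n = 0$, let $0 < \lambda < 2^{\aleph_0}$, and let $\{\mathcal F_\xi : \xi < \lambda\}$ be a family of $\mu_{\hat p}$-nonmeasurable filters on $\omega$. Then $\bigcap_{\xi<\lambda}\mathcal F_\xi$ is a Lebesgue nonmeasurable filter. In fact, it is $\mu_{\hat q}$-nonmeasurable for every sequence $\hat q = (q_n)_{n\in\omega}$ in $(0,\tfrac12]$ such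 that $\lim_{n\to\infty} q_n/p_n = \infty$. -/

import Mathlib

open MeasureTheory ProbabilityTheory Filter Topology

/-- Two conditions of a notion of forcing are compatible if they have a common extension
(smaller elements are stronger conditions). -/
def ForcingCompatible {P : Type*} [Preorder P] (a b : P) : Prop :=
  ∃ c, c ≤ a ∧ c ≤ b

/-- The countable chain condition: every set of pairwise incompatible conditions is countable. -/
def IsCCC (P : Type*) [Preorder P] : Prop :=
  ∀ A : Set P, (A.Pairwise fun a b => ¬ ForcingCompatible a b) → A.Countable

/-- A set of conditions is dense if every condition has an extension in it. -/
def IsForcingDense {P : Type*} [Preorder P] (D : Set P) : Prop :=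
  ∀ a, ∃ d ∈ D, d ≤ a

/-- Martin's Axiom: for every nonempty ccc notion of forcing and every family of fewer than
`2 ^ ℵ₀` dense sets there is a filter that meets all of them. -/
def MartinsAxiom : Prop :=
  ∀ (P : Type) [Preorder P] [Nonempty P], IsCCC P →
    ∀ 𝒟 : Set (Set P), Cardinal.mk 𝒟 < Cardinal.continuum → (∀ D ∈ 𝒟, IsForcingDense D) →
      ∃ G : Order.PFilter P, ∀ D ∈ 𝒟, ((G : Set P) ∩ D).Nonempty

/-- A real number in `(0, 1/2]`, as an element of the unit interval. -/
def toUnit (t : Set.Ioc (0 : ℝ) (1 / 2)) : unitInterval :=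
  ⟨t, t.2.1.le, t.2.2.trans (by norm_num)⟩

/-- The product measure on `2 ^ ω` that gives `{x | x n = 1}` mass `p n`
and `{x | x n = 0}` mass `1 - p n`. -/
noncomputable def muHat (p : ℕ → Set.Ioc (0 : ℝ) (1 / 2)) : Measure (ℕ → Bool) :=
  Measure.infinitePi fun n => bernoulliMeasure true false (toUnit (p n))

/-- The usual (Lebesgue) measure on `2 ^ ω`: all the parameters are `1/2`. -/
noncomputable def cantorLebesgue : Measure (ℕ → Bool) :=
  muHat fun _ => ⟨1 / 2, by norm_num, le_rfl⟩

/-- A filter on `ω`, in the sense of a proper nonprincipal filter: it omits the empty set and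
contains all cofinite sets. -/
def IsNonprincipalFilter (F : Filter ℕ) : Prop :=
  F.NeBot ∧ F ≤ cofinite

/-- The set of characteristic functions of the elements of a filter on `ω`. -/
def charFunctions (F : Filter ℕ) : Set (ℕ → Bool) :=
  {x | {n | x n = true} ∈ F}

/-- A filter on `ω` is nonmeasurable for `μ` if the set of characteristic functions of its elements
is not measurable for the completion of `μ`. -/
def NonmeasurableFilter (μ : Measure (ℕ → Bool)) (F : Filter ℕ) : Prop :=
  ¬ NullMeasurableSet (charFunctions F) μ

/-!
A nonmeasurable filter is not null, while a measurable one is null: by the zero-one law it would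
otherwise have measure one, and since all parameters are at most `1/2` it would contain two disjoint
sets. So suppose that the intersection of the filters is `q`-null. A null set lies in the limit
superior of small sets `E l`, each depending on two consecutive blocks of a partition of `ω`
into intervals, and the partition can be so coarse that `m * p k ≤ q k` on the `m`-th block. Since
`(1 - p k) ^ m ≥ 1 - q k`, the union of `m` independent `p`-random sets is then, on the `m`-th
block, dominated by a `q`-random set, so it extends with high probability to a set that avoids what
is small for `q`.

By Martin's Axiom fewer than `2 ^ ℵ₀` functions are captured by one slalom. This makes it possible
to choose by transfinite recursion `X ξ` in the `ξ`-th filter, so generic that the finite unions of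
these sets stay extendible on almost all blocks, and then `Y ξ` in the same way over the slalom that
captures the finite unions of the `X ξ`. So for finite sets `a` and `b` of indices, the `X ξ` with
`ξ` in `a` and the `Y ξ` with `ξ` in `b` can be covered together on every block beyond two bounds,
one for `a` and one for `b`. Hence the forcing with finite approximations to a common cover `Z` of
all the `X ξ ∩ Y ξ` is ccc: of two conditions with the same initial segment, one keeps its promises
by covering the `X ξ` and the other by covering the `Y ξ`. Such a `Z` belongs to all the filters and
avoids all `E l`, a contradiction.
-/

/-! ### Martin's Axiom for covering conditions -/

/-- Conditions of the forcing that adds a function `h` with `∀ᶠ m, E ξ m (h m)` for every `ξ`: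
the initial segment `h ↾ len`, and a finite set of indices `ξ` for which `E ξ m (h m)` is promised
for `len ≤ m`. The values of `val` from `len` on are irrelevant; `N` bounds from below the length
at which a set of promises can be made. -/
structure CoverCondition {ι : Type*} {α : ℕ → Type*} (E : ι → ∀ m, α m → Prop)
    (N : Finset ι → ℕ) where
  len : ℕ
  val : ∀ m, α m
  idx : Finset ι
  le_len : N idx ≤ len

namespace CoverCondition

section

variable {ι : Type*} {α : ℕ → Type*} {E : ι → ∀ m, α m → Prop} {N : Finset ι → ℕ}

instance : Preorder (CoverCondition E N) where
  le c d := d.len ≤ c.len ∧ (∀ m < d.len, c.val m = d.val m) ∧ d.idx ⊆ c.idx ∧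
    ∀ m, d.len ≤ m → m < c.len → ∀ ξ ∈ d.idx, E ξ m (c.val m)
  le_refl _ := ⟨le_rfl, fun _ _ => rfl, subset_rfl, fun _ h₁ h₂ => absurd h₂ (not_lt.2 h₁)⟩
  le_trans a b c := by
    rintro ⟨hab, vab, iab, eab⟩ ⟨hbc, vbc, ibc, ebc⟩
    refine ⟨hbc.trans hab, fun m hm => (vab m (hm.trans_le hbc)).trans (vbc m hm), ibc.trans iab,
      fun m h₁ h₂ ξ hξ => ?_⟩
    rcases lt_or_ge m b.len with h | h
    · exact vab m h ▸ ebc m h₁ h ξ hξ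
    · exact eab m h h₂ ξ (ibc hξ)

lemma exists_le_and_le
    (hE : ∀ A B : Finset ι, ∀ m, N A ≤ m → N B ≤ m → ∃ h, ∀ ξ, ξ ∈ A ∨ ξ ∈ B → E ξ m h)
    (c d : CoverCondition E N) (hlen : c.len = d.len) (hval : ∀ m < c.len, c.val m = d.val m)
    (A : Finset ι) (k : ℕ) :
    ∃ e, e ≤ c ∧ e ≤ d ∧ A ⊆ e.idx ∧ k ≤ e.len := by
  classical
  have hex : ∀ m, ∃ h, (m < c.len → h = c.val m) ∧
      (c.len ≤ m → ∀ ξ, ξ ∈ c.idx ∨ ξ ∈ d.idx → E ξ m h) := by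
    intro m
    rcases lt_or_ge m c.len with hm | hm
    · exact ⟨c.val m, fun _ => rfl, fun h => absurd hm (not_lt.2 h)⟩
    · obtain ⟨h, hh⟩ := hE c.idx d.idx m (c.le_len.trans hm) (d.le_len.trans (hlen ▸ hm))
      exact ⟨h, fun h => absurd h (not_lt.2 hm), fun _ => hh⟩
  choose g hg_lt hg_ge using hex
  let I := c.idx ∪ d.idx ∪ A
  refine ⟨⟨max (max c.len k) (N I), g, I, le_max_right _ _⟩, ⟨by simp, hg_lt,
    fun ξ hξ => by simp [I, hξ], fun m hm _ ξ hξ => hg_ge m hm ξ (.inl hξ)⟩,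
    ⟨by simp [← hlen], fun m hm => ?_, fun ξ hξ => by simp [I, hξ],
      fun m hm _ ξ hξ => hg_ge m (hlen ▸ hm) ξ (.inr hξ)⟩,
    fun ξ hξ => by simp [I, hξ], by simp⟩
  rw [← hlen] at hm
  exact (hg_lt m hm).trans (hval m hm)

lemma isCCC [∀ m, Countable (α m)]
    (hE : ∀ A B : Finset ι, ∀ m, N A ≤ m → N B ≤ m → ∃ h, ∀ ξ, ξ ∈ A ∨ ξ ∈ B → E ξ m h) :
    IsCCC (CoverCondition E N) := by
  intro A hA
  let segment : CoverCondition E N → Σ n : ℕ, ∀ i : Fin n, α i := fun c => ⟨c.len, fun i => c.val i⟩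
  refine Set.countable_of_injective_of_countable_image (f := segment) ?_ (Set.to_countable _)
  intro c hc d hd hcd
  by_contra hne
  obtain ⟨hlen, hval⟩ := Sigma.mk.inj hcd
  have hval : ∀ m < c.len, c.val m = d.val m := by
    intro m hm
    have hcast : ∀ {n n' : ℕ} (_ : n = n') {f : ∀ i : Fin n, α i} {f' : ∀ i : Fin n', α i},
        HEq f f' → ∀ h h', f ⟨m, h⟩ = f' ⟨m, h'⟩ := by
      rintro n _ rfl f _ ⟨⟩ _ _
      rfl
    exact hcast hlen hval hm (hlen ▸ hm)
  obtain ⟨e, hec, hed, -⟩ := exists_le_and_le hE c d hlen hval ∅ 0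
  exact hA hc hd hne ⟨e, hec, hed⟩

end

end CoverCondition

section

variable {ι : Type*} {α : ℕ → Type} [∀ m, Countable (α m)]

lemma MartinsAxiom.exists_eventually_cover_of_small_universe (hMA : MartinsAxiom) {ι : Type}
    [∀ m, Nonempty (α m)] (hι : Cardinal.mk ι < Cardinal.continuum)
    {E : ι → ∀ m, α m → Prop} {N : Finset ι → ℕ}
    (hE : ∀ A B : Finset ι, ∀ m, N A ≤ m → N B ≤ m → ∃ h, ∀ ξ, ξ ∈ A ∨ ξ ∈ B → E ξ m h) :
    ∃ h : ∀ m, α m, ∀ ξ, ∀ᶠ m in atTop, E ξ m (h m) := by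
  have : Nonempty (CoverCondition E N) := ⟨⟨N ∅, fun _ => Classical.arbitrary _, ∅, le_rfl⟩⟩
  let D : ι ⊕ ℕ → Set (CoverCondition E N) :=
    Sum.elim (fun ξ => {c | ξ ∈ c.idx}) (fun m => {c | m < c.len})
  have hD_card : Cardinal.mk (Set.range D) < Cardinal.continuum := by
    refine Cardinal.mk_range_le.trans_lt ?_
    rw [Cardinal.mk_sum]
    simpa using Cardinal.add_lt_of_lt Cardinal.aleph0_le_continuum hι Cardinal.aleph0_lt_continuum
  have hD_dense : ∀ i, IsForcingDense (D i) := by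
    rintro (ξ | m) c
    · obtain ⟨e, hec, -, he, -⟩ :=
        CoverCondition.exists_le_and_le hE c c rfl (fun _ _ => rfl) {ξ} 0
      exact ⟨e, Finset.singleton_subset_iff.1 he, hec⟩
    · obtain ⟨e, hec, -, -, he⟩ :=
        CoverCondition.exists_le_and_le hE c c rfl (fun _ _ => rfl) ∅ (m + 1)
      exact ⟨e, he, hec⟩
  obtain ⟨G, hG⟩ := hMA _ (CoverCondition.isCCC hE) (Set.range D) hD_card
    (Set.forall_mem_range.2 hD_dense)
  choose c hcG hc using fun m => hG _ ⟨Sum.inr m, rfl⟩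
  refine ⟨fun m => (c m).val m, fun ξ => ?_⟩
  obtain ⟨d, hdG, hd⟩ := hG _ ⟨Sum.inl ξ, rfl⟩
  filter_upwards [eventually_ge_atTop d.len] with m hm
  obtain ⟨e, -, hec, hed⟩ := G.directed (c m) (hcG m) d hdG
  exact hec.2.1 m (hc m) ▸ hed.2.2.2 m hm ((hc m).trans_le hec.1) ξ hd

theorem MartinsAxiom.exists_eventually_cover (hMA : MartinsAxiom) [∀ m, Nonempty (α m)]
    (hι : Cardinal.mk ι < Cardinal.continuum) {E : ι → ∀ m, α m → Prop} {N : Finset ι → ℕ}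
    (hE : ∀ A B : Finset ι, ∀ m, N A ≤ m → N B ≤ m → ∃ h, ∀ ξ, ξ ∈ A ∨ ξ ∈ B → E ξ m h) :
    ∃ h : ∀ m, α m, ∀ ξ, ∀ᶠ m in atTop, E ξ m (h m) := by
  obtain ⟨s, ⟨e⟩⟩ : ∃ s : Set ℝ, Nonempty (ι ≃ s) := by
    have hle : Cardinal.lift.{0} (Cardinal.mk ι) ≤ Cardinal.lift (Cardinal.mk ℝ) := by
      simpa [Cardinal.mk_real] using hι.le
    obtain ⟨f⟩ := Cardinal.lift_mk_le'.1 hle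
    exact ⟨_, ⟨Equiv.ofInjective f f.injective⟩⟩
  have hs : Cardinal.mk s < Cardinal.continuum := by
    rw [← Cardinal.lift_lt.{0}, ← Cardinal.lift_mk_eq'.2 ⟨e⟩]
    simpa using hι
  obtain ⟨h, hh⟩ := hMA.exists_eventually_cover_of_small_universe hs
    (E := fun t => E (e.symm t)) (N := fun A => N (A.map e.symm.toEmbedding)) fun A B m hA hB => by
      obtain ⟨h, hh⟩ := hE _ _ m hA hB
      exact ⟨h, fun t ht => hh _ (by simpa using ht)⟩
  exact ⟨h, fun ξ => by simpa using hh (e ξ)⟩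

theorem MartinsAxiom.exists_slalom (hMA : MartinsAxiom)
    (hι : Cardinal.mk ι < Cardinal.continuum) (f : ι → ∀ m, α m) {g : ℕ → ℕ}
    (hg : Tendsto g atTop atTop) :
    ∃ S : ∀ m, Finset (α m), (∀ m, (S m).card ≤ g m) ∧ ∀ ξ, ∀ᶠ m in atTop, f ξ m ∈ S m := by
  classical
  choose N hN using fun A : Finset ι => eventually_atTop.1 (hg.eventually_ge_atTop (2 * A.card))
  have (m : ℕ) : Nonempty {S : Finset (α m) // S.card ≤ g m} := ⟨∅, by simp⟩
  obtain ⟨h, hh⟩ := hMA.exists_eventually_cover hι (N := N)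
    (α := fun m => {S : Finset (α m) // S.card ≤ g m}) (E := fun ξ m S => f ξ m ∈ S.1)
    fun A B m hA hB => by
      refine ⟨⟨(A ∪ B).image (f · m), ?_⟩, fun ξ hξ =>
        Finset.mem_image_of_mem _ (Finset.mem_union.2 hξ)⟩
      have h_image := Finset.card_image_le (s := A ∪ B) (f := (f · m))
      have h_union := Finset.card_union_le A B
      have hA := hN A m hA
      have hB := hN B m hB
      omega
  exact ⟨fun m => (h m).1, fun m => (h m).2, hh⟩

lemma mk_finset_lt_continuum (hι : Cardinal.mk ι < Cardinal.continuum) :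
    Cardinal.mk (Finset ι) < Cardinal.continuum := by
  rcases finite_or_infinite ι with h | h
  · exact (Cardinal.lt_aleph0_of_finite (Finset ι)).trans Cardinal.aleph0_lt_continuum
  · rwa [Cardinal.mk_finset_of_infinite]

end

/-! ### Generic families of points -/

section

variable {ι Ω : Type*} [MeasurableSpace Ω] {μ : Measure Ω} {L : ℕ → Type}
  {π : ∀ m, Ω → L m} {G : ∀ m, ℕ → Set (L m)}

lemma exists_mem_eventually_sup_mem [∀ m, SemilatticeSup (L m)]
    (hG : ∀ m k, ∀ V ∈ G m (k + 1), μ {x | V ⊔ π m x ∉ G m k} ≤ 16⁻¹ ^ m)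
    {R : ∀ m, Finset (L m)} (hR : ∀ m, (R m).card ≤ 4 ^ m) {C : Set Ω} (hC : μ C ≠ 0) :
    ∃ x ∈ C, ∀ᶠ m in atTop, ∀ V ∈ R m, ∀ k < m, V ∈ G m (k + 1) → V ⊔ π m x ∈ G m k := by
  let bad (m : ℕ) : Set Ω :=
    ⋃ V ∈ R m, ⋃ k ∈ Finset.range m, {x | V ∈ G m (k + 1) ∧ V ⊔ π m x ∉ G m k}
  have hbad (m : ℕ) : μ (bad m) ≤ 2⁻¹ ^ m := by
    have hle (V : L m) (k : ℕ) : μ {x | V ∈ G m (k + 1) ∧ V ⊔ π m x ∉ G m k} ≤ 16⁻¹ ^ m := by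
      by_cases hV : V ∈ G m (k + 1)
      · simpa [hV] using hG m k V hV
      · simp [hV]
    calc μ (bad m) ≤ ∑ V ∈ R m, ∑ _ ∈ Finset.range m, 16⁻¹ ^ m :=
          (measure_biUnion_finset_le _ _).trans <| Finset.sum_le_sum fun V _ =>
            (measure_biUnion_finset_le _ _).trans <| Finset.sum_le_sum fun k _ => hle V k
      _ = (R m).card * m * 16⁻¹ ^ m := by simp [mul_assoc]
      _ ≤ 4 ^ m * 2 ^ m * 16⁻¹ ^ m := by
          gcongr
          · exact_mod_cast hR m
          · exact_mod_cast Nat.lt_two_pow_self.le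
      _ = 2⁻¹ ^ m := by
          rw [← mul_pow, ← mul_pow]
          congr 1
          rw [show (16 : ENNReal) = 4 * 2 * 2 by norm_num,
            ENNReal.mul_inv (by simp) (by simp), ← mul_assoc,
            ENNReal.mul_inv_cancel (by norm_num) (by finiteness), one_mul]
  have hnull : μ {x | ∃ᶠ m in atTop, x ∈ bad m} = 0 := by
    refine measure_setOfPred_frequently_eq_zero (ne_top_of_le_ne_top ?_ (ENNReal.tsum_le_tsum hbad))
    simp [ENNReal.tsum_geometric]
  obtain ⟨x, hxC, hx⟩ : (C \ {x | ∃ᶠ m in atTop, x ∈ bad m}).Nonempty :=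
    nonempty_of_measure_ne_zero (μ := μ) (by rwa [measure_sdiff_null hnull])
  refine ⟨x, hxC, (not_frequently.1 hx).mono fun m hm V hV k hk hVk => ?_⟩
  by_contra hsup
  exact hm (by simpa [bad] using ⟨V, hV, k, hVk, hk, hsup⟩)

variable [∀ m, Countable (L m)]

lemma MartinsAxiom.exists_generic_point [∀ m, SemilatticeSup (L m)] [∀ m, OrderBot (L m)]
    (hMA : MartinsAxiom) (hι : Cardinal.mk ι < Cardinal.continuum)
    (hG : ∀ m k, ∀ V ∈ G m (k + 1), μ {x | V ⊔ π m x ∉ G m k} ≤ 16⁻¹ ^ m)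
    {S : ∀ m, Finset (L m)} (hS : ∀ m, (S m).card ≤ 2 ^ m) (X : ι → Ω) {C : Set Ω}
    (hC : μ C ≠ 0) :
    ∃ x ∈ C, ∀ A : Finset ι, ∀ᶠ m in atTop, ∀ w ∈ S m, ∀ k < m,
      (w ⊔ A.sup fun ξ => π m (X ξ)) ∈ G m (k + 1) →
        (w ⊔ A.sup fun ξ => π m (X ξ)) ⊔ π m x ∈ G m k := by
  classical
  obtain ⟨T, hT, hmem⟩ := hMA.exists_slalom (mk_finset_lt_continuum hι)
    (fun (A : Finset ι) m => A.sup fun ξ => π m (X ξ))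
    (tendsto_pow_atTop_atTop_of_one_lt one_lt_two)
  have hR (m : ℕ) : (Finset.image₂ (· ⊔ ·) (S m) (T m)).card ≤ 4 ^ m :=
    calc _ ≤ (S m).card * (T m).card := Finset.card_image₂_le _ _ _
      _ ≤ 2 ^ m * 2 ^ m := Nat.mul_le_mul (hS m) (hT m)
      _ = 4 ^ m := by norm_num [← mul_pow]
  obtain ⟨x, hxC, hx⟩ := exists_mem_eventually_sup_mem hG hR hC
  refine ⟨x, hxC, fun A => ?_⟩
  filter_upwards [hx, hmem A] with m hm hA w hw
  exact hm _ (Finset.mem_image₂_of_mem hw hA)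

lemma MartinsAxiom.exists_generic_family [∀ m, SemilatticeSup (L m)] [∀ m, OrderBot (L m)]
    (hMA : MartinsAxiom) (hι : Cardinal.mk ι < Cardinal.continuum)
    (hG : ∀ m k, ∀ V ∈ G m (k + 1), μ {x | V ⊔ π m x ∉ G m k} ≤ 16⁻¹ ^ m)
    {S : ∀ m, Finset (L m)} (hS : ∀ m, (S m).card ≤ 2 ^ m) {C : ι → Set Ω}
    (hC : ∀ ξ, μ (C ξ) ≠ 0) :
    ∃ X : ι → Ω, (∀ ξ, X ξ ∈ C ξ) ∧ ∀ A : Finset ι, ∀ᶠ m in atTop, ∀ w ∈ S m, ∀ k,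
      k + A.card ≤ m → w ∈ G m (k + A.card) → (w ⊔ A.sup fun ξ => π m (X ξ)) ∈ G m k := by
  classical
  let _ : LinearOrder ι := linearOrderOfSTO WellOrderingRel
  have : WellFoundedLT ι := ⟨WellOrderingRel.isWellOrder.wf⟩
  choose next hnext_mem hnext using fun ξ (X : Set.Iio ξ → Ω) =>
    hMA.exists_generic_point ((Cardinal.mk_set_le _).trans_lt hι) hG hS X (hC ξ)
  let X : ι → Ω := wellFounded_lt.fix fun ξ X => next ξ fun η => X η η.2
  have hX (ξ : ι) : X ξ = next ξ fun η => X η := wellFounded_lt.fix_eq _ _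
  refine ⟨X, fun ξ => hX ξ ▸ hnext_mem ξ _, fun A => ?_⟩
  induction A using Finset.induction_on_max with
  | empty => simp
  | insert ξ A hA ih =>
    have hsup (m : ℕ) :
        ((A.subtype (· ∈ Set.Iio ξ)).sup fun η => π m (X η)) = A.sup fun η => π m (X η) := by
      conv_rhs => rw [← Finset.subtype_map_of_mem (p := (· ∈ Set.Iio ξ)) hA, Finset.sup_map]
      rfl
    filter_upwards [ih, hnext ξ (fun η => X η) (A.subtype (· ∈ Set.Iio ξ))]
      with m hm hnext_m w hw k hk hwk
    simp only [hsup, ← hX] at hnext_m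
    rw [Finset.card_insert_of_notMem fun h => (hA ξ h).false, add_comm A.card, ← add_assoc]
      at hk hwk
    rw [Finset.sup_insert, sup_comm (π m (X ξ)), ← sup_assoc]
    exact hnext_m w hw k (by omega) (hm w hw (k + 1) hk hwk)

theorem MartinsAxiom.exists_eventually_inf_le [∀ m, Lattice (L m)] [∀ m, OrderBot (L m)]
    (hMA : MartinsAxiom) (hι : Cardinal.mk ι < Cardinal.continuum)
    (hG : ∀ m k, ∀ V ∈ G m (k + 1), μ {x | V ⊔ π m x ∉ G m k} ≤ 16⁻¹ ^ m)
    (hbot : ∀ m, ⊥ ∈ G m m) {H : ∀ m, Set (L m)} (hH : ∀ m k, ∀ V ∈ G m k, ∃ h ∈ H m, V ≤ h)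
    {C : ι → Set Ω} (hC : ∀ ξ, μ (C ξ) ≠ 0) :
    ∃ h : ∀ m, L m, (∀ m, h m ∈ H m) ∧
      ∀ ξ, ∃ x ∈ C ξ, ∃ y ∈ C ξ, ∀ᶠ m in atTop, π m x ⊓ π m y ≤ h m := by
  obtain ⟨X, hXC, hX⟩ := hMA.exists_generic_family hι hG (S := fun _ => {⊥})
    (fun m => by simpa using Nat.one_le_two_pow) hC
  obtain ⟨S, hS, hXS⟩ := hMA.exists_slalom (mk_finset_lt_continuum hι)
    (fun (A : Finset ι) m => A.sup fun ξ => π m (X ξ))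
    (tendsto_pow_atTop_atTop_of_one_lt one_lt_two)
  obtain ⟨Y, hYC, hY⟩ := hMA.exists_generic_family hι hG hS hC
  choose N hN using fun A => eventually_atTop.1
    ((hX A).and <| (hXS A).and <| (hY A).and <| eventually_ge_atTop (2 * A.card))
  have (m : ℕ) : Nonempty (H m) :=
    let ⟨h, hhH, _⟩ := hH m m ⊥ (hbot m)
    ⟨h, hhH⟩
  obtain ⟨h, hh⟩ := hMA.exists_eventually_cover hι (α := fun m => H m) (N := N)
    (E := fun ξ m h => π m (X ξ) ⊓ π m (Y ξ) ≤ h) fun A B m hA hB => by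
      obtain ⟨hXA, hAS, -, hAm⟩ := hN A m hA
      obtain ⟨-, -, hYB, hBm⟩ := hN B m hB
      have hA_mem : (A.sup fun ξ => π m (X ξ)) ∈ G m (m - A.card - B.card + B.card) := by
        have hm : m - A.card - B.card + B.card + A.card = m := by omega
        simpa using hXA ⊥ (by simp) (m - A.card - B.card + B.card) hm.le
          (by rw [hm]; exact hbot m)
      obtain ⟨h, hhH, hle⟩ := hH m _ _ (hYB _ hAS (m - A.card - B.card) (by omega) hA_mem)
      obtain ⟨hA_le, hB_le⟩ := sup_le_iff.1 hle
      refine ⟨⟨h, hhH⟩, fun ξ hξ => hξ.elim (fun hξ => ?_) fun hξ => ?_⟩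
      · exact inf_le_left.trans ((Finset.le_sup (f := fun ξ => π m (X ξ)) hξ).trans hA_le)
      · exact inf_le_right.trans ((Finset.le_sup (f := fun ξ => π m (Y ξ)) hξ).trans hB_le)
  exact ⟨fun m => h m, fun m => (h m).2, fun ξ => ⟨X ξ, hXC ξ, Y ξ, hYC ξ, hh ξ⟩⟩

end

/-! ### Product measures -/

section

variable {α β δ : Type*} [MeasurableSpace α] [MeasurableSpace β] [MeasurableSpace δ]

lemma measure_setOf_le_measure_section_le {μ : Measure α} {ν : Measure β} [SFinite ν]
    {ρ : Measure δ} {f : α × β → δ} (hf : MeasurePreserving f (μ.prod ν) ρ) {E : Set δ}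
    (hE : MeasurableSet E) {c d : ENNReal} (hc₀ : c ≠ 0) (hc : c ≠ ⊤) (h : ρ E ≤ c * d) :
    μ {x | c ≤ ν {y | f (x, y) ∈ E}} ≤ d := by
  rw [← hf.measure_preimage hE.nullMeasurableSet, Measure.prod_apply (hf.measurable hE)] at h
  rw [← ENNReal.mul_le_mul_iff_right hc₀ hc]
  exact (mul_meas_ge_le_lintegral (measurable_measure_prodMk_left (hf.measurable hE)) c).trans h

end

section

variable {ι : Type*} {X : ι → Type*}

/-- The union of the fibres of the restriction map `x ↦ x ↾ s` that meet `A`. -/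
def saturation (s : Set ι) (A : Set (∀ i, X i)) : Set (∀ i, X i) :=
  s.domRestrict ⁻¹' (s.domRestrict '' A)

lemma mem_saturation {s : Set ι} {A : Set (∀ i, X i)} {x : ∀ i, X i} :
    x ∈ saturation s A ↔ ∃ w ∈ A, ∀ i ∈ s, w i = x i := by
  simp [saturation, funext_iff]

lemma subset_saturation (s : Set ι) (A : Set (∀ i, X i)) : A ⊆ saturation s A :=
  Set.subset_preimage_image _ _

lemma dependsOn_mem_saturation (s : Set ι) (A : Set (∀ i, X i)) :
    DependsOn (· ∈ saturation s A) s := by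
  intro x y hxy
  simp only [saturation, Set.mem_preimage, Set.dependsOn_domRestrict s hxy]

lemma saturation_eq_self {s : Set ι} {A : Set (∀ i, X i)} (hA : DependsOn (· ∈ A) s) :
    saturation s A = A := by
  refine Set.Subset.antisymm (fun x hx => ?_) (subset_saturation s A)
  obtain ⟨w, hw, hwx⟩ := mem_saturation.1 hx
  exact (hA hwx).mp hw

variable [∀ i, MeasurableSpace (X i)]

lemma measurableSet_of_dependsOn [∀ i, Finite (X i)] [∀ i, MeasurableSingletonClass (X i)]
    {s : Set ι} (hs : s.Finite) {A : Set (∀ i, X i)} (hA : DependsOn (· ∈ A) s) :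
    MeasurableSet A := by
  have := hs.to_subtype
  rw [← saturation_eq_self hA]
  exact measurableSet_preimage (by fun_prop) (Set.toFinite _).measurableSet

end

theorem measurePreserving_prod_infinitePi {ι : Type*} {X Y Z : ι → Type*}
    [∀ i, MeasurableSpace (X i)] [∀ i, MeasurableSpace (Y i)] [∀ i, MeasurableSpace (Z i)]
    {μ : ∀ i, Measure (X i)} {ν : ∀ i, Measure (Y i)} {ρ : ∀ i, Measure (Z i)}
    [∀ i, IsProbabilityMeasure (μ i)] [∀ i, IsProbabilityMeasure (ν i)]
    [∀ i, IsProbabilityMeasure (ρ i)] {f : ∀ i, X i × Y i → Z i}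
    (hf : ∀ i, MeasurePreserving (f i) ((μ i).prod (ν i)) (ρ i)) :
    MeasurePreserving (fun (z : (∀ i, X i) × (∀ i, Y i)) i => f i (z.1 i, z.2 i))
      ((Measure.infinitePi μ).prod (Measure.infinitePi ν)) (Measure.infinitePi ρ) := by
  have hf_meas (i : ι) : Measurable (f i) := (hf i).measurable
  have hm : Measurable fun (z : (∀ i, X i) × (∀ i, Y i)) i => f i (z.1 i, z.2 i) := by fun_prop
  refine ⟨hm, Measure.eq_infinitePi _ fun s t ht => ?_⟩
  have hbox : MeasurableSet ((s : Set ι).pi t) := .pi s.countable_toSet fun i _ => ht i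
  have hsection (x : ∀ i, X i) : Measure.infinitePi ν
      (Prod.mk x ⁻¹' ((fun (z : (∀ i, X i) × (∀ i, Y i)) i => f i (z.1 i, z.2 i)) ⁻¹'
        (s : Set ι).pi t)) = ∏ i ∈ s, ν i (Prod.mk (x i) ⁻¹' (f i ⁻¹' t i)) := by
    rw [← Measure.infinitePi_pi ν fun i _ => measurable_prodMk_left (hf_meas i (ht i))]
    rfl
  have hg (i : ι) : Measurable fun a : X i => ν i (Prod.mk a ⁻¹' (f i ⁻¹' t i)) :=
    measurable_measure_prodMk_left (hf_meas i (ht i))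
  simp only [Measure.map_apply hm hbox, Measure.prod_apply (hm hbox), hsection]
  rw [lintegral_prod_eq_prod_lintegral_of_indepFun s
    (fun i (x : ∀ i, X i) => ν i (Prod.mk (x i) ⁻¹' (f i ⁻¹' t i)))
    (iIndepFun_infinitePi (P := μ) (X := fun i a => ν i (Prod.mk a ⁻¹' (f i ⁻¹' t i))) hg)
    (fun i => (hg i).comp (measurable_pi_apply i))]
  refine Finset.prod_congr rfl fun i _ => ?_
  rw [← (hf i).measure_preimage (ht i).nullMeasurableSet, Measure.prod_apply (hf_meas i (ht i)),
    ← (measurePreserving_eval_infinitePi μ i).lintegral_comp (hg i)]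

section

variable {ι : Type*} {X : ι → Type*} [∀ i, MeasurableSpace (X i)] {μ : ∀ i, Measure (X i)}
  [∀ i, IsProbabilityMeasure (μ i)]

lemma measurePreserving_piecewise (s : Set ι) [∀ i, Decidable (i ∈ s)] :
    MeasurePreserving (fun z : (∀ i, X i) × (∀ i, X i) => s.piecewise z.1 z.2)
      ((Measure.infinitePi μ).prod (Measure.infinitePi μ)) (Measure.infinitePi μ) := by
  refine measurePreserving_prod_infinitePi (f := fun i z => if i ∈ s then z.1 else z.2) fun i => ?_
  by_cases hi : i ∈ s
  · simpa only [hi, if_true] using measurePreserving_fst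
  · simpa only [hi, if_false] using measurePreserving_snd

lemma infinitePi_eq_zero_or_compl_eq_zero {C : Set (∀ i, X i)}
    (hC : NullMeasurableSet C (Measure.infinitePi μ))
    (htail : ∀ x y : ∀ i, X i, (∀ᶠ i in cofinite, x i = y i) → x ∈ C → y ∈ C) :
    Measure.infinitePi μ C = 0 ∨ Measure.infinitePi μ Cᶜ = 0 := by
  classical
  refine or_iff_not_imp_left.2 fun hC₀ => ?_
  have hbox (s : Finset ι) (t : ∀ i, Set (X i)) (ht : ∀ i, MeasurableSet (t i)) :
      Measure.infinitePi μ ((s : Set ι).pi t ∩ C) =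
        (∏ i ∈ s, μ i (t i)) * Measure.infinitePi μ C := by
    have hpre : (fun z : (∀ i, X i) × (∀ i, X i) => (s : Set ι).piecewise z.1 z.2) ⁻¹'
        ((s : Set ι).pi t ∩ C) = (s : Set ι).pi t ×ˢ C := by
      ext ⟨x, y⟩
      have hxy : ∀ᶠ i in cofinite, (s : Set ι).piecewise x y i = y i :=
        s.eventually_cofinite_notMem.mono fun i hi => Set.piecewise_eq_of_notMem _ _ _ hi
      refine and_congr (forall₂_congr fun i hi => ?_)
        ⟨htail _ _ hxy, htail _ _ (hxy.mono fun i => Eq.symm)⟩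
      exact iff_of_eq (congrArg (· ∈ t i) (Set.piecewise_eq_of_mem _ _ _ hi))
    have hbox : MeasurableSet ((s : Set ι).pi t) := .pi s.countable_toSet fun i _ => ht i
    rw [← (measurePreserving_piecewise (s : Set ι)).measure_preimage
        (hbox.nullMeasurableSet.inter hC), hpre, Measure.prod_prod,
      Measure.infinitePi_pi μ fun i _ => ht i]
  -- Conditioning on `C` does not change the measure of a box, so it does not change the measure.
  have hcond : (Measure.infinitePi μ C)⁻¹ • (Measure.infinitePi μ).restrict C =
      Measure.infinitePi μ := by
    refine Measure.eq_infinitePi _ fun s t ht => ?_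
    rw [Measure.smul_apply, Measure.restrict_apply₀' hC, hbox s t ht, smul_eq_mul, mul_left_comm,
      ENNReal.inv_mul_cancel hC₀ (measure_ne_top _ _), mul_one]
  rw [← hcond, Measure.smul_apply, Measure.restrict_apply₀' hC, Set.compl_inter_self,
    measure_empty, smul_zero]

lemma infinitePi_saturation_le [∀ i, Finite (X i)] [∀ i, MeasurableSingletonClass (X i)]
    {s t : Set ι} (hst : (s ∪ t).Finite) {A : Set (∀ i, X i)} (hA : DependsOn (· ∈ A) (s ∪ t))
    {c d : ENNReal} (hc₀ : c ≠ 0) (hc : c ≠ ⊤)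
    (hct : ∀ w : ∀ i, X i, c ≤ Measure.infinitePi μ {y | ∀ i ∈ t, y i = w i})
    (h : Measure.infinitePi μ A ≤ c * d) :
    Measure.infinitePi μ (saturation s A) ≤ d := by
  classical
  refine (measure_mono fun x hx => ?_).trans (measure_setOf_le_measure_section_le
    (measurePreserving_piecewise s) (measurableSet_of_dependsOn hst hA) hc₀ hc h)
  obtain ⟨w, hw, hwx⟩ := mem_saturation.1 hx
  refine (hct w).trans (measure_mono fun y hy => (hA fun i hi => ?_).mp hw)
  by_cases his : i ∈ s
  · simp [his, hwx]
  · simp [his, hy i (hi.resolve_left his)]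

lemma exists_le_infinitePi_setOf_eq [∀ i, Finite (X i)] [∀ i, MeasurableSingletonClass (X i)]
    (hμ : ∀ i (b : X i), μ i {b} ≠ 0) {t : Set ι} (ht : t.Finite) :
    ∃ c : ENNReal, c ≠ 0 ∧ c ≠ ⊤ ∧
      ∀ w : ∀ i, X i, c ≤ Measure.infinitePi μ {y | ∀ i ∈ t, y i = w i} := by
  have hle (w : ∀ i, X i) :
      ∏ i ∈ ht.toFinset, ⨅ b, μ i {b} ≤ Measure.infinitePi μ {y | ∀ i ∈ t, y i = w i} := by
    have hbox : {y | ∀ i ∈ t, y i = w i} = (ht.toFinset : Set ι).pi fun i => {w i} := by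
      ext y
      simp
    rw [hbox, Measure.infinitePi_pi μ fun i _ => measurableSet_singleton _]
    exact Finset.prod_le_prod' fun i _ => iInf_le _ _
  obtain ⟨w⟩ := (Measure.infinitePi μ).nonempty_of_neZero
  refine ⟨_, Finset.prod_ne_zero_iff.2 fun i _ => ?_, ((hle w).trans_lt (measure_lt_top _ _)).ne,
    hle⟩
  have := (μ i).nonempty_of_neZero
  obtain ⟨b, hb⟩ := exists_eq_ciInf_of_finite (f := fun b => μ i {b})
  exact hb ▸ hμ i b

end

/-! ### Random subsets with independent coordinates -/

section

variable {κ : Type*}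

/-- The law of a random subset of `κ` that contains each `i` independently with probability
`a i`. -/
noncomputable abbrev bernoulliPi (a : κ → unitInterval) : Measure (κ → Bool) :=
  Measure.infinitePi fun i => bernoulliMeasure true false (a i)

lemma bernoulliMeasure_singleton_false (u : unitInterval) :
    bernoulliMeasure true false (unitInterval.symm u) {false} = ENNReal.ofReal u := by
  rw [bernoulliMeasure_apply_of_notMem_of_mem _ (by simp) (by simp) (by simp),
    unitInterval.symm_symm, ENNReal.ofReal, Real.toNNReal_of_nonneg u.2.1]
  rfl

lemma bernoulliMeasure_singleton_ne_zero {a : unitInterval} (ha₀ : a ≠ 0) (ha₁ : a ≠ 1)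
    (b : Bool) : bernoulliMeasure true false a {b} ≠ 0 := by
  cases b
  · rw [bernoulliMeasure_apply_of_notMem_of_mem _ (by simp) (by simp) (by simp)]
    simpa [← NNReal.coe_eq_zero, sub_eq_zero] using Ne.symm (unitInterval.coe_ne_one.2 ha₁)
  · rw [bernoulliMeasure_apply_of_mem_of_notMem _ (by simp) (by simp) (by simp)]
    simpa [← NNReal.coe_eq_zero] using ha₀

lemma measure_bool_ext {μ ν : Measure Bool} [IsProbabilityMeasure μ] [IsProbabilityMeasure ν]
    (h : μ {false} = ν {false}) : μ = ν := by
  refine Measure.ext_of_singleton (Bool.forall_bool.2 ⟨h, ?_⟩)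
  rw [show ({true} : Set Bool) = {false}ᶜ by ext (_ | _) <;> simp,
    prob_compl_eq_one_sub (by simp), prob_compl_eq_one_sub (by simp), h]

lemma measurePreserving_sup_bernoulliMeasure (u v : unitInterval) :
    MeasurePreserving (fun z : Bool × Bool => z.1 ⊔ z.2)
      ((bernoulliMeasure true false (unitInterval.symm u)).prod
        (bernoulliMeasure true false (unitInterval.symm v)))
      (bernoulliMeasure true false (unitInterval.symm (u * v))) := by
  have hm : Measurable fun z : Bool × Bool => z.1 ⊔ z.2 := measurable_of_finite _
  have := Measure.isProbabilityMeasure_map (μ := (bernoulliMeasure true false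
    (unitInterval.symm u)).prod (bernoulliMeasure true false (unitInterval.symm v))) hm.aemeasurable
  refine ⟨hm, measure_bool_ext ?_⟩
  have hpre : (fun z : Bool × Bool => z.1 ⊔ z.2) ⁻¹' {false} = {false} ×ˢ {false} := by
    ext ⟨x, y⟩
    simp
  rw [Measure.map_apply hm (by simp), hpre, Measure.prod_prod, bernoulliMeasure_singleton_false,
    bernoulliMeasure_singleton_false, bernoulliMeasure_singleton_false,
    ← ENNReal.ofReal_mul u.2.1, Set.Icc.coe_mul]

lemma measurePreserving_sup_bernoulliPi (u v : κ → unitInterval) :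
    MeasurePreserving (fun z : (κ → Bool) × (κ → Bool) => z.1 ⊔ z.2)
      ((bernoulliPi fun i => unitInterval.symm (u i)).prod
        (bernoulliPi fun i => unitInterval.symm (v i)))
      (bernoulliPi fun i => unitInterval.symm (u i * v i)) :=
  measurePreserving_prod_infinitePi fun i => measurePreserving_sup_bernoulliMeasure (u i) (v i)

lemma measurePreserving_compl_bernoulliPi (a : κ → unitInterval) :
    MeasurePreserving compl (bernoulliPi fun i => unitInterval.symm (a i)) (bernoulliPi a) := by
  have hmap (i : κ) : (bernoulliMeasure true false (unitInterval.symm (a i))).map (fun b => !b) =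
      bernoulliMeasure true false (a i) := by
    rw [map_bernoulliMeasure' _ _ (measurable_of_finite _), bernoulliMeasure_def,
      bernoulliMeasure_def, unitInterval.symm_symm, add_comm]
    rfl
  refine ⟨measurable_pi_lambda _ fun i =>
    (measurable_of_finite (fun b => !b)).comp (measurable_pi_apply i), ?_⟩
  exact (Measure.infinitePi_map_pi _ fun _ => measurable_of_finite _).trans
    (congrArg _ (funext hmap))

lemma measurePreserving_domRestrict_bernoulliPi (a : κ → unitInterval) (s : Set κ) :
    MeasurePreserving s.domRestrict (bernoulliPi a) (bernoulliPi fun i : s => a i) :=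
  ⟨by fun_prop, Measure.infinitePi_map_restrict' _⟩

lemma dvd_of_le_unitInterval {a b : unitInterval} (h : a ≤ b) : b ∣ a := by
  rcases eq_or_ne b 0 with rfl | hb
  · exact le_antisymm h a.2.1 ▸ dvd_rfl
  · refine ⟨⟨a / b, unitInterval.div_mem a.2.1 b.2.1 h⟩, Subtype.ext ?_⟩
    rw [Set.Icc.coe_mul, mul_div_cancel₀ _ (unitInterval.coe_ne_zero.2 hb)]

lemma symm_pow_dvd_symm {p q : unitInterval} {m : ℕ} (h : m * (p : ℝ) ≤ q) :
    unitInterval.symm p ^ m ∣ unitInterval.symm q := by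
  refine dvd_of_le_unitInterval (Subtype.coe_le_coe.1 ?_)
  have hpow : 1 + m * (-p : ℝ) ≤ (1 + -p) ^ m :=
    one_add_mul_le_pow (by linarith [p.2.2]) m
  simp only [unitInterval.coe_symm_eq, Set.Icc.coe_pow]
  rw [sub_eq_add_neg 1 (p : ℝ)]
  linarith

end

lemma mem_charFunctions_of_eventually_le {F : Filter ℕ} (hF : F ≤ cofinite) {x y : ℕ → Bool}
    (hxy : ∀ᶠ n in cofinite, x n ≤ y n) (hx : x ∈ charFunctions F) : y ∈ charFunctions F := by
  have hx : ∀ᶠ n in F, x n = true := hx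
  filter_upwards [hx, hF hxy] with n hn hle using Bool.eq_true_of_true_le (hn ▸ hle)

lemma inf_mem_charFunctions {F : Filter ℕ} {x y : ℕ → Bool} (hx : x ∈ charFunctions F)
    (hy : y ∈ charFunctions F) : x ⊓ y ∈ charFunctions F := by
  have hx : ∀ᶠ n in F, x n = true := hx
  filter_upwards [hx, hy] with n hxn hyn
  rw [Pi.inf_apply, hxn, hyn, inf_idem]

lemma bernoulliPi_charFunctions_eq_zero {a : ℕ → unitInterval}
    (ha : ∀ n, a n ≤ unitInterval.symm (a n)) {F : Filter ℕ} (hF : IsNonprincipalFilter F)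
    (hm : NullMeasurableSet (charFunctions F) (bernoulliPi a)) :
    bernoulliPi a (charFunctions F) = 0 := by
  refine (infinitePi_eq_zero_or_compl_eq_zero hm fun x y hxy =>
    mem_charFunctions_of_eventually_le hF.2 (hxy.mono fun n => le_of_eq)).resolve_right
    fun hconull => ?_
  -- If `x` has law `a` and `r` is independent of `x` and suitable, then `(x ⊔ r)ᶜ` has law `a`.
  choose s hs using fun n => dvd_of_le_unitInterval (ha n)
  have hsup : MeasurePreserving (fun z : (ℕ → Bool) × (ℕ → Bool) => z.1 ⊔ z.2)
      ((bernoulliPi a).prod (bernoulliPi fun n => unitInterval.symm (s n)))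
      (bernoulliPi fun n => unitInterval.symm (a n)) := by
    have h := measurePreserving_sup_bernoulliPi (fun n => unitInterval.symm (a n)) s
    simpa only [← hs, unitInterval.symm_symm] using h
  have hcompl := (measurePreserving_compl_bernoulliPi a).comp hsup
  obtain ⟨⟨x, r⟩, hx, hy⟩ := ((measurePreserving_fst.quasiMeasurePreserving.ae hconull).and
    (hcompl.quasiMeasurePreserving.ae hconull)).exists
  have := hF.1
  obtain ⟨n, hn⟩ : ∃ n, (x ⊓ (x ⊔ r)ᶜ) n = true :=
    (show ∀ᶠ n in F, _ from inf_mem_charFunctions hx hy).exists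
  have hbot : x ⊓ (x ⊔ r)ᶜ = ⊥ := (disjoint_compl_right.mono_left le_sup_left).eq_bot
  rw [hbot] at hn
  exact Bool.false_ne_true hn

/-! ### Covering random sets off a block-wise small set -/

section

variable {κ : Type*} {p s : κ → unitInterval} {J : Set (κ → Bool)} {δ : ENNReal}

/-- The sets `V` whose union with a random set `z` probably avoids `J`, where each `i` is missing
from `z` with probability `(1 - p i) ^ k * s i`: this is the law of the union of `k` independent
random sets of law `bernoulliPi p` and a further one. So `k` is the number of `p`-random sets that
may still be added to `V`. -/
def likelyAvoiding (p s : κ → unitInterval) (J : Set (κ → Bool)) (δ : ENNReal) (k : ℕ) :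
    Set (κ → Bool) :=
  {V | bernoulliPi (fun i => unitInterval.symm (unitInterval.symm (p i) ^ k * s i))
    {z | V ⊔ z ∈ J} ≤ 2⁻¹ * δ ^ k}

lemma measure_sup_notMem_likelyAvoiding_le [Finite κ] (hδ₀ : δ ≠ 0) (hδ : δ ≠ ⊤) {k : ℕ}
    {V : κ → Bool} (hV : V ∈ likelyAvoiding p s J δ (k + 1)) :
    bernoulliPi p {x | V ⊔ x ∉ likelyAvoiding p s J δ k} ≤ δ := by
  have hsup := measurePreserving_sup_bernoulliPi (fun i => unitInterval.symm (p i))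
    fun i => unitInterval.symm (p i) ^ k * s i
  simp only [unitInterval.symm_symm, ← mul_assoc, ← pow_succ'] at hsup
  refine (measure_mono fun x hx => ?_).trans (measure_setOf_le_measure_section_le hsup
    (E := {z | V ⊔ z ∈ J}) (Set.toFinite _).measurableSet (c := 2⁻¹ * δ ^ k) (by simp [hδ₀])
    (by finiteness) (hV.trans_eq (by rw [pow_succ, mul_assoc])))
  simp only [likelyAvoiding, Set.mem_ofPred_eq, not_le, sup_assoc] at hx
  exact hx.le

lemma exists_le_notMem_of_mem_likelyAvoiding (hδ : δ ≤ 1) {k : ℕ} {V : κ → Bool}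
    (hV : V ∈ likelyAvoiding p s J δ k) : ∃ h ∈ Jᶜ, V ≤ h := by
  by_contra! hJ
  have huniv : {z | V ⊔ z ∈ J} = Set.univ :=
    Set.eq_univ_of_forall fun z => by_contra fun hz => hJ _ hz le_sup_left
  have h : 1 ≤ 2⁻¹ * δ ^ k := by simpa [likelyAvoiding, huniv] using hV
  have : (2⁻¹ : ENNReal) * δ ^ k < 1 :=
    (mul_le_of_le_one_right' (pow_le_one' hδ k)).trans_lt (by norm_num)
  exact this.not_ge h

end

/-- The measure that a set of subsets of the `m`-th block may have in
`MartinsAxiom.exists_avoiding_inf_le`. -/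
noncomputable def blockBound (m : ℕ) : ENNReal :=
  2⁻¹ * (16⁻¹ ^ m) ^ m

lemma blockBound_ne_zero (m : ℕ) : blockBound m ≠ 0 := by
  simp [blockBound]

lemma blockBound_ne_top (m : ℕ) : blockBound m ≠ ⊤ := by
  simp [blockBound, ENNReal.mul_eq_top]

lemma blockBound_antitone : Antitone blockBound := by
  intro m n hmn
  have h : (16⁻¹ : ENNReal) ≤ 1 := by simp
  simp only [blockBound, ← pow_mul]
  gcongr 2⁻¹ * ?_
  exact pow_le_pow_right_of_le_one' h (Nat.mul_le_mul hmn hmn)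

section

variable {ι : Type*} {κ : Type} {p q : κ → unitInterval} {β : κ → ℕ} {C : ι → Set (κ → Bool)}

lemma finite_preimage_of_tendsto (hβ : Tendsto β cofinite atTop) {s : Set ℕ} (hs : s.Finite) :
    (β ⁻¹' s).Finite := by
  simpa using hβ.mono_right atTop_le_cofinite hs.compl_mem_cofinite

lemma MartinsAxiom.exists_avoiding_inf_le (hMA : MartinsAxiom)
    (hι : Cardinal.mk ι < Cardinal.continuum) (hβ : Tendsto β cofinite atTop)
    (hpq : ∀ k, β k * (p k : ℝ) ≤ q k) {J : ∀ m, Set (β ⁻¹' {m} → Bool)}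
    (hJ : ∀ m, bernoulliPi (fun i : β ⁻¹' {m} => q i) (J m) ≤ blockBound m)
    (hC : ∀ ξ, bernoulliPi p (C ξ) ≠ 0) :
    ∃ Z : κ → Bool, (∀ m, (β ⁻¹' {m}).domRestrict Z ∉ J m) ∧
      ∀ ξ, ∃ x ∈ C ξ, ∃ y ∈ C ξ, ∀ᶠ k in cofinite, x k ⊓ y k ≤ Z k := by
  have hfin (m : ℕ) : Finite (β ⁻¹' {m}) := finite_preimage_of_tendsto hβ (Set.finite_singleton m)
  choose s hs using fun k => symm_pow_dvd_symm (hpq k)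
  let G (m k : ℕ) : Set (β ⁻¹' {m} → Bool) :=
    likelyAvoiding (fun i => p i) (fun i => s i) (J m) (16⁻¹ ^ m) k
  have hG (m k : ℕ) : ∀ V ∈ G m (k + 1),
      bernoulliPi p {x | V ⊔ (β ⁻¹' {m}).domRestrict x ∉ G m k} ≤ 16⁻¹ ^ m := by
    intro V hV
    refine Eq.trans_le ?_ (measure_sup_notMem_likelyAvoiding_le (by simp) (by simp) hV)
    rw [← (measurePreserving_domRestrict_bernoulliPi p _).measure_preimage
      (Set.toFinite _).measurableSet.nullMeasurableSet]
    rfl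
  have hbot (m : ℕ) : ⊥ ∈ G m m := by
    have hq (i : β ⁻¹' {m}) :
        unitInterval.symm (unitInterval.symm (p i) ^ m * s i) = q i := by
      rw [← unitInterval.symm_symm (q i), hs, show β i = m from i.2]
    simp only [G, likelyAvoiding, Set.mem_ofPred_eq, hq, bot_sup_eq]
    exact hJ m
  obtain ⟨h, hhJ, hh⟩ := hMA.exists_eventually_inf_le hι hG hbot
    (fun m k V hV => exists_le_notMem_of_mem_likelyAvoiding (pow_le_one' (by simp) m) hV) hC
  refine ⟨fun k => h (β k) ⟨k, rfl⟩, fun m => ?_, fun ξ => ?_⟩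
  · have hZ : (β ⁻¹' {m}).domRestrict (fun k => h (β k) ⟨k, rfl⟩) = h m := by
      ext ⟨k, rfl⟩
      rfl
    exact hZ ▸ hhJ m
  · obtain ⟨x, hx, y, hy, hxy⟩ := hh ξ
    exact ⟨x, hx, y, hy, (hβ.eventually hxy).mono fun k hk => hk ⟨k, rfl⟩⟩

lemma MartinsAxiom.exists_notMem_inf_le (hMA : MartinsAxiom)
    (hι : Cardinal.mk ι < Cardinal.continuum) (hβ : Tendsto β cofinite atTop)
    (hpq : ∀ k, β k * (p k : ℝ) ≤ q k) {c : ℕ → ℕ} (hc : ∀ l, c l ≤ l + 1)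
    {E : ℕ → Set (κ → Bool)} (hE_dep : ∀ l, DependsOn (· ∈ E l) (β ⁻¹' {c l}))
    (hE : ∀ l, bernoulliPi q (E l) ≤ blockBound (l + 1) * 2⁻¹ ^ (l + 1))
    (hC : ∀ ξ, bernoulliPi p (C ξ) ≠ 0) :
    ∃ Z : κ → Bool, (∀ l, Z ∉ E l) ∧
      ∀ ξ, ∃ x ∈ C ξ, ∃ y ∈ C ξ, ∀ᶠ k in cofinite, x k ⊓ y k ≤ Z k := by
  have hfin (m : ℕ) : Finite (β ⁻¹' {m}) := finite_preimage_of_tendsto hβ (Set.finite_singleton m)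
  let J (m : ℕ) : Set (β ⁻¹' {m} → Bool) :=
    ⋃ (l) (_ : c l = m), (β ⁻¹' {m}).domRestrict '' E l
  have hpre (m : ℕ) : (β ⁻¹' {m}).domRestrict ⁻¹' J m = ⋃ (l) (_ : c l = m), E l := by
    simp only [J, Set.preimage_iUnion]
    exact Set.iUnion₂_congr fun l hl => saturation_eq_self (hl ▸ hE_dep l)
  have hJ (m : ℕ) : bernoulliPi (fun i : β ⁻¹' {m} => q i) (J m) ≤ blockBound m := by
    have hle (l : ℕ) : bernoulliPi q (⋃ (_ : c l = m), E l) ≤ blockBound m * 2⁻¹ ^ (l + 1) := by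
      by_cases hl : c l = m
      · simp only [hl, Set.iUnion_true]
        grw [hE l, blockBound_antitone (hl ▸ hc l)]
      · simp [hl]
    calc bernoulliPi (fun i : β ⁻¹' {m} => q i) (J m)
        = bernoulliPi q (⋃ (l) (_ : c l = m), E l) := by
          rw [← hpre, (measurePreserving_domRestrict_bernoulliPi q _).measure_preimage
            (Set.toFinite _).measurableSet.nullMeasurableSet]
      _ ≤ ∑' l, blockBound m * 2⁻¹ ^ (l + 1) :=
          (measure_iUnion_le _).trans (ENNReal.tsum_le_tsum hle)
      _ = blockBound m := by
          rw [ENNReal.tsum_mul_left, ENNReal.tsum_geometric_add_one, ENNReal.one_sub_inv_two,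
            inv_inv, ENNReal.inv_mul_cancel (by simp) (by simp), mul_one]
  obtain ⟨Z, hZJ, hZ⟩ := hMA.exists_avoiding_inf_le hι hβ hpq hJ hC
  refine ⟨Z, fun l hl => hZJ (c l) ?_, hZ⟩
  exact Set.mem_iUnion₂.2 ⟨l, rfl, Z, hl, rfl⟩

end

/-! ### Covering a null set by block-wise small sets -/

lemma exists_strictMono_of_eventually {P : ℕ → ℕ → ℕ → Prop}
    (hP : ∀ l a, ∀ᶠ b in atTop, P l a b) :
    ∃ n : ℕ → ℕ, n 0 = 0 ∧ StrictMono n ∧ ∀ l, P l (n l) (n (l + 1)) := by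
  choose f hfP hf using fun l a => ((hP l a).and (eventually_gt_atTop a)).exists
  let n (l : ℕ) : ℕ := Nat.rec 0 f l
  exact ⟨n, rfl, strictMono_nat_of_lt_succ fun l => hf l (n l), fun l => hfP l (n l)⟩

lemma exists_galoisConnection_of_strictMono {n : ℕ → ℕ} (h₀ : n 0 = 0) (hn : StrictMono n) :
    ∃ β : ℕ → ℕ, GaloisConnection n β := by
  refine ⟨fun k => Nat.findGreatest (n · ≤ k) k, fun l k => ⟨fun h => ?_, fun h => ?_⟩⟩
  · exact Nat.le_findGreatest (hn.le_apply.trans h) h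
  · exact (hn.monotone h).trans
      (Nat.findGreatest_spec (P := (n · ≤ k)) (Nat.zero_le k) (h₀.trans_le (Nat.zero_le k)))

lemma exists_ge_mem_Ico {j : ℕ → ℕ} (hj : Tendsto j atTop atTop) {L i : ℕ} (hi : j L ≤ i) :
    ∃ l ≥ L, i ∈ Set.Ico (j l) (j (l + 1)) := by
  by_contra! h
  have hle (l : ℕ) (hl : L ≤ l) : j l ≤ i := by
    induction l, hl using Nat.le_induction with
    | base => exact hi
    | succ l hl ih => exact not_lt.1 fun hlt => h l hl ⟨ih, hlt⟩
  obtain ⟨l, hl, hil⟩ := ((eventually_ge_atTop L).and (hj.eventually_gt_atTop i)).exists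
  exact (hle l hl).not_gt hil

section

variable {X : ℕ → Type*} [∀ i, TopologicalSpace (X i)]

lemma exists_iUnion_dependsOn_eq_of_isOpen {U : Set (∀ i, X i)} (hU : IsOpen U) :
    ∃ D : ℕ → Set (∀ i, X i), Pairwise (Function.onFun Disjoint D) ∧
      (∀ n, DependsOn (· ∈ D n) (Set.Iio n)) ∧ ⋃ n, D n = U := by
  let V (n : ℕ) : Set (∀ i, X i) := (saturation (Set.Iio n) Uᶜ)ᶜ
  have hV (n : ℕ) : DependsOn (· ∈ V n) (Set.Iio n) := fun x y hxy =>
    congrArg Not (dependsOn_mem_saturation _ Uᶜ hxy)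
  refine ⟨disjointed V, disjoint_disjointed V, fun n x y hxy => ?_, ?_⟩
  · simp only [disjointed_eq_inter_compl, Set.mem_inter_iff, Set.mem_iInter, Set.mem_compl_iff]
    have hxy' (m : ℕ) (hm : m ≤ n) : x ∈ V m ↔ y ∈ V m :=
      iff_of_eq (hV m fun i hi => hxy i (hi.trans_le hm))
    exact propext (and_congr (hxy' n le_rfl) (forall₂_congr fun m hm => not_congr (hxy' m hm.le)))
  · rw [iUnion_disjointed]
    refine Set.Subset.antisymm (Set.iUnion_subset fun n =>
      Set.compl_subset_comm.1 (subset_saturation _ _)) fun x hx => ?_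
    obtain ⟨I, u, hu, hIu⟩ := isOpen_pi_iff.1 hU x hx
    obtain ⟨n, hn⟩ := I.exists_nat_subset_range
    refine Set.mem_iUnion.2 ⟨n, fun hxn => ?_⟩
    obtain ⟨w, hw, hwx⟩ := mem_saturation.1 hxn
    exact hw (hIu fun i hi => hwx i (Finset.mem_range.1 (hn hi)) ▸ (hu i hi).2)

variable [∀ i, Finite (X i)] [∀ i, MeasurableSpace (X i)] [∀ i, MeasurableSingletonClass (X i)]

lemma exists_summable_cover {μ : Measure (∀ i, X i)} [μ.OuterRegular] {N : Set (∀ i, X i)}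
    (hN : μ N = 0) :
    ∃ C : ℕ → Set (∀ i, X i), (∀ j, ∃ d, DependsOn (· ∈ C j) (Set.Iio d)) ∧
      ∑' j, μ (C j) ≠ ⊤ ∧ ∀ x ∈ N, ∃ᶠ j in atTop, x ∈ C j := by
  have hU (k : ℕ) : ∃ U, N ⊆ U ∧ IsOpen U ∧ μ U ≤ 2⁻¹ ^ k := by
    obtain ⟨U, hNU, hU, hμU⟩ := N.exists_isOpen_le_add μ (ε := 2⁻¹ ^ k) (by simp)
    exact ⟨U, hNU, hU, by simpa only [hN, zero_add] using hμU⟩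
  choose U hNU hUo hμU using hU
  choose D hD_disj hD hDU using fun k => exists_iUnion_dependsOn_eq_of_isOpen (hUo k)
  refine ⟨fun j => D j.unpair.1 j.unpair.2, fun j => ⟨_, hD _ _⟩, ?_, fun x hx => ?_⟩
  · have hsum (k : ℕ) : ∑' n, μ (D k n) ≤ 2⁻¹ ^ k := by
      rw [← measure_iUnion (hD_disj k) fun n => measurableSet_of_dependsOn (Set.finite_Iio n)
        (hD k n), hDU]
      exact hμU k
    have hpair : ∑' j : ℕ, μ (D j.unpair.1 j.unpair.2) = ∑' (k : ℕ) (n : ℕ), μ (D k n) := by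
      rw [← ENNReal.tsum_prod]
      exact Nat.pairEquiv.symm.tsum_eq fun z : ℕ × ℕ => μ (D z.1 z.2)
    rw [hpair]
    refine ne_top_of_le_ne_top ?_ (ENNReal.tsum_le_tsum hsum)
    rw [ENNReal.tsum_geometric, ENNReal.one_sub_inv_two, inv_inv]
    finiteness
  · refine frequently_atTop.2 fun k => ?_
    obtain ⟨n, hn⟩ := Set.mem_iUnion.1 ((hDU k).symm ▸ hNU k hx)
    exact ⟨Nat.pair k n, Nat.left_le_pair k n, by simpa only [Nat.unpair_pair] using hn⟩

lemma exists_strictMono_cover {μ : Measure (∀ i, X i)} [μ.OuterRegular] {N : Set (∀ i, X i)}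
    (hN : μ N = 0) {g : ℕ → ℕ} (hg : Tendsto g atTop atTop) {ε : ℕ → ℕ → ENNReal}
    (hε : ∀ l a, ε l a ≠ 0) :
    ∃ n : ℕ → ℕ, n 0 = 0 ∧ StrictMono n ∧ (∀ l, ∀ k ≥ n (l + 1), l + 1 ≤ g k) ∧
      ∃ A : ℕ → Set (∀ i, X i), (∀ l, DependsOn (· ∈ A l) (Set.Iio (n (l + 2)))) ∧
        (∀ l, μ (A l) ≤ ε l (n l)) ∧ ∀ x ∈ N, ∃ᶠ l in atTop, x ∈ A l := by
  obtain ⟨C, hC_dep, hC_sum, hCN⟩ := exists_summable_cover hN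
  choose d hd using hC_dep
  have htail (l a : ℕ) : ∃ j ≥ l, ∑' i, μ (C (i + j)) ≤ ε l a :=
    ((eventually_ge_atTop l).and ((ENNReal.tendsto_sum_nat_add _ hC_sum).eventually_le_const
      (pos_iff_ne_zero.2 (hε l a)))).exists
  choose j hj hj_sum using htail
  have hstep (l a : ℕ) : ∀ᶠ b in atTop, (∀ i < j l a, d i ≤ b) ∧ ∀ k ≥ b, l + 1 ≤ g k :=
    ((Set.finite_Iio _).eventually_all.2 fun i _ => eventually_ge_atTop (d i)).and
      (eventually_forall_ge_atTop.2 (hg.eventually_ge_atTop (l + 1)))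
  obtain ⟨n, hn₀, hn, hnP⟩ := exists_strictMono_of_eventually hstep
  refine ⟨n, hn₀, hn, fun l => (hnP l).2,
    fun l => ⋃ i ∈ Set.Ico (j l (n l)) (j (l + 1) (n (l + 1))), C i, fun l x y hxy => ?_,
    fun l => ?_, fun x hx => frequently_atTop.2 fun L => ?_⟩
  · simp only [Set.mem_iUnion]
    refine propext (exists_congr fun i => exists_congr fun hi => iff_of_eq (hd i fun k hk => ?_))
    exact hxy k (hk.trans_le ((hnP (l + 1)).1 i hi.2))
  · refine (measure_mono (Set.iUnion₂_subset fun i hi => ?_)).trans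
      ((measure_iUnion_le _).trans (hj_sum l (n l)))
    exact Set.subset_iUnion_of_subset (i - j l (n l)) (by rw [Nat.sub_add_cancel hi.1])
  · obtain ⟨i, hi, hxi⟩ := frequently_atTop.1 (hCN x hx) (j L (n L))
    obtain ⟨l, hl, hil⟩ := exists_ge_mem_Ico (j := fun l => j l (n l))
      (tendsto_atTop_mono (fun l => hj l (n l)) tendsto_id) hi
    exact ⟨l, hl, Set.mem_iUnion₂.2 ⟨i, hil, hxi⟩⟩

theorem exists_two_block_cover {μ : ∀ i, Measure (X i)} [∀ i, IsProbabilityMeasure (μ i)]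
    [(Measure.infinitePi μ).OuterRegular] (hμ : ∀ i (b : X i), μ i {b} ≠ 0) {N : Set (∀ i, X i)}
    (hN : Measure.infinitePi μ N = 0) {g : ℕ → ℕ} (hg : Tendsto g atTop atTop)
    {δ : ℕ → ENNReal} (hδ : ∀ l, δ l ≠ 0) :
    ∃ β : ℕ → ℕ, Tendsto β atTop atTop ∧ β ≤ g ∧ ∃ E : ℕ → Set (∀ i, X i),
      (∀ l, DependsOn (· ∈ E l) (β ⁻¹' {l, l + 1})) ∧
      (∀ l, Measure.infinitePi μ (E l) ≤ δ l) ∧ ∀ x ∈ N, ∃ᶠ l in atTop, x ∈ E l := by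
  choose c hc₀ hc_top hc using fun a => exists_le_infinitePi_setOf_eq hμ (Set.finite_Iio a)
  obtain ⟨n, hn₀, hn, hng, A, hA_dep, hA, hAN⟩ :=
    exists_strictMono_cover hN hg fun l a => mul_ne_zero (hc₀ a) (hδ l)
  obtain ⟨β, hβ⟩ := exists_galoisConnection_of_strictMono hn₀ hn
  have hblocks (l : ℕ) : β ⁻¹' {l, l + 1} ∪ Set.Iio (n l) = Set.Iio (n (l + 2)) := by
    ext k
    have h₀ := hβ l k
    have h₂ := hβ (l + 2) k
    have := hn.monotone (Nat.le_add_right l 2)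
    simp only [Set.mem_union, Set.mem_preimage, Set.mem_insert_iff, Set.mem_singleton_iff,
      Set.mem_Iio]
    omega
  refine ⟨β, ?_, fun k => ?_, fun l => saturation (β ⁻¹' {l, l + 1}) (A l),
    fun l => dependsOn_mem_saturation _ _, fun l => ?_,
    fun x hx => (hAN x hx).mono fun l hl => subset_saturation _ _ hl⟩
  · exact tendsto_atTop.2 fun l => (eventually_ge_atTop (n l)).mono fun k => (hβ l k).1
  · rcases h : β k with _ | l
    · exact Nat.zero_le _
    · exact hng l k ((hβ _ _).2 h.ge)
  · exact infinitePi_saturation_le (hblocks l ▸ Set.finite_Iio _) (hblocks l ▸ hA_dep l)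
      (hc₀ _) (hc_top _) (hc _) (hA l)

end

/-! ### Intersections of nonmeasurable filters -/

lemma piecewise_mem_iff_of_dependsOn {κ : Type*} {X : κ → Type*} {s O : Set κ}
    [∀ k, Decidable (k ∈ O)] {E : Set (∀ k, X k)} (hE : DependsOn (· ∈ E) s) {x x' y y' : ∀ k, X k}
    (hx : ∀ k ∈ s ∩ O, x k = x' k) (hy : ∀ k ∈ s \ O, y k = y' k) :
    O.piecewise x y ∈ E ↔ O.piecewise x' y' ∈ E := by
  refine iff_of_eq (hE fun k hk => ?_)
  by_cases hkO : k ∈ O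
  · simpa only [O.piecewise_eq_of_mem _ _ hkO] using hx k ⟨hk, hkO⟩
  · simpa only [O.piecewise_eq_of_notMem _ _ hkO] using hy k ⟨hk, hkO⟩

section

variable {ι : Type*} {p q : ℕ → unitInterval} {F : ι → Filter ℕ}

lemma MartinsAxiom.exists_notMem_mem_charFunctions (hMA : MartinsAxiom)
    (hι : Cardinal.mk ι < Cardinal.continuum) {β : ℕ → ℕ} (hβ : Tendsto β cofinite atTop)
    (hpq : ∀ k, β k * (p k : ℝ) ≤ q k) {c : ℕ → ℕ} (hc : ∀ l, c l ≤ l + 1)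
    {E : ℕ → Set (ℕ → Bool)} (hE_dep : ∀ l, DependsOn (· ∈ E l) (β ⁻¹' {c l}))
    (hE : ∀ l, bernoulliPi q (E l) ≤ blockBound (l + 1) * 2⁻¹ ^ (l + 1))
    (hF : ∀ ξ, F ξ ≤ cofinite) (hFp : ∀ ξ, bernoulliPi p (charFunctions (F ξ)) ≠ 0) :
    ∃ Z : ℕ → Bool, (∀ l, Z ∉ E l) ∧ ∀ ξ, Z ∈ charFunctions (F ξ) := by
  obtain ⟨Z, hZE, hZ⟩ := hMA.exists_notMem_inf_le hι hβ hpq hc hE_dep hE hFp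
  refine ⟨Z, hZE, fun ξ => ?_⟩
  obtain ⟨x, hx, y, hy, hxy⟩ := hZ ξ
  exact mem_charFunctions_of_eventually_le (hF ξ) hxy (inf_mem_charFunctions hx hy)

-- By Fubini, `Z` may be chosen on the odd blocks first and on the even blocks afterwards.
lemma MartinsAxiom.exists_notMem_mem_charFunctions_of_two_block (hMA : MartinsAxiom)
    (hι : Cardinal.mk ι < Cardinal.continuum) {β : ℕ → ℕ} (hβ : Tendsto β cofinite atTop)
    (hpq : ∀ k, β k * (p k : ℝ) ≤ q k) {E : ℕ → Set (ℕ → Bool)}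
    (hE_dep : ∀ l, DependsOn (· ∈ E l) (β ⁻¹' {l, l + 1}))
    (hE : ∀ l, bernoulliPi q (E l) ≤ (blockBound (l + 1) * 2⁻¹ ^ (l + 1)) ^ 2)
    (hF : ∀ ξ, F ξ ≤ cofinite) (hFp : ∀ ξ, bernoulliPi p (charFunctions (F ξ)) ≠ 0) :
    ∃ Z : ℕ → Bool, (∀ l, Z ∉ E l) ∧ ∀ ξ, Z ∈ charFunctions (F ξ) := by
  classical
  let γ (l : ℕ) : ENNReal := blockBound (l + 1) * 2⁻¹ ^ (l + 1)
  let O : Set ℕ := {k | Odd (β k)}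
  have hblock (l k : ℕ) (hk : k ∈ β ⁻¹' {l, l + 1}) : β k = l ∨ β k = l + 1 := hk
  have hodd (l : ℕ) : β ⁻¹' {l, l + 1} ∩ O ⊆ β ⁻¹' {2 * (l / 2) + 1} := by
    rintro k ⟨hk, hkO⟩
    have := Nat.odd_iff.1 hkO
    have := hblock l k hk
    exact show β k = _ by omega
  have heven (l : ℕ) : β ⁻¹' {l, l + 1} \ O ⊆ β ⁻¹' {2 * ((l + 1) / 2)} := by
    rintro k ⟨hk, hkO⟩
    have := Nat.not_odd_iff.1 hkO
    have := hblock l k hk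
    exact show β k = _ by omega
  obtain ⟨Z₁, hZ₁E, hZ₁⟩ := hMA.exists_notMem_mem_charFunctions hι hβ hpq
    (c := fun l => 2 * (l / 2) + 1) (fun l => by omega)
    (E := fun l => {x | γ l ≤ bernoulliPi q {y | O.piecewise x y ∈ E l}})
    (fun l x x' hx => by
      simp only [Set.mem_ofPred_eq, piecewise_mem_iff_of_dependsOn (hE_dep l)
        (fun k hk => hx k (hodd l hk)) (fun _ _ => rfl)])
    (fun l => measure_setOf_le_measure_section_le (measurePreserving_piecewise O)
      (measurableSet_of_dependsOn (finite_preimage_of_tendsto hβ (by simp)) (hE_dep l))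
      (by simp [γ, blockBound_ne_zero]) (by finiteness [blockBound_ne_top (l + 1)])
      ((hE l).trans_eq (sq _))) hF hFp
  obtain ⟨Z₂, hZ₂E, hZ₂⟩ := hMA.exists_notMem_mem_charFunctions hι hβ hpq
    (c := fun l => 2 * ((l + 1) / 2)) (fun l => by omega)
    (E := fun l => {y | O.piecewise Z₁ y ∈ E l})
    (fun l y y' hy => propext (piecewise_mem_iff_of_dependsOn (hE_dep l) (fun _ _ => rfl)
      fun k hk => hy k (heven l hk)))
    (fun l => (not_le.1 (hZ₁E l)).le) hF hFp
  have hle : Z₁ ⊓ Z₂ ≤ O.piecewise Z₁ Z₂ :=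
    Set.le_piecewise (fun _ _ => inf_le_left) (fun _ _ => inf_le_right)
  exact ⟨O.piecewise Z₁ Z₂, hZ₂E, fun ξ => mem_charFunctions_of_eventually_le (hF ξ)
    (.of_forall hle) (inf_mem_charFunctions (hZ₁ ξ) (hZ₂ ξ))⟩

theorem MartinsAxiom.bernoulliPi_charFunctions_iSup_ne_zero (hMA : MartinsAxiom)
    (hι : Cardinal.mk ι < Cardinal.continuum) (hq₀ : ∀ n, q n ≠ 0) (hq₁ : ∀ n, q n ≠ 1)
    (hpq : Tendsto (fun n => (q n : ℝ) / p n) atTop atTop)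
    (hF : ∀ ξ, F ξ ≤ cofinite) (hFp : ∀ ξ, bernoulliPi p (charFunctions (F ξ)) ≠ 0) :
    bernoulliPi q (charFunctions (⨆ ξ, F ξ)) ≠ 0 := by
  intro hN
  obtain ⟨β, hβ, hβg, E, hE_dep, hE, hNE⟩ := exists_two_block_cover
    (fun n => bernoulliMeasure_singleton_ne_zero (hq₀ n) (hq₁ n)) hN
    (tendsto_nat_floor_atTop.comp hpq) (δ := fun l => (blockBound (l + 1) * 2⁻¹ ^ (l + 1)) ^ 2)
    (fun l => by simp [blockBound_ne_zero])
  have hβpq (k : ℕ) : β k * (p k : ℝ) ≤ q k := mul_le_of_le_div₀ (q k).2.1 (p k).2.1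
    ((Nat.cast_le.2 (hβg k)).trans (Nat.floor_le (div_nonneg (q k).2.1 (p k).2.1)))
  obtain ⟨Z, hZE, hZ⟩ := hMA.exists_notMem_mem_charFunctions_of_two_block hι
    (Nat.cofinite_eq_atTop ▸ hβ) hβpq hE_dep hE hF hFp
  obtain ⟨l, hl⟩ := (hNE Z (mem_iSup.2 hZ)).exists
  exact hZE l hl

end

lemma isNonprincipalFilter_iSup {ι : Type*} [Nonempty ι] {F : ι → Filter ℕ}
    (hF : ∀ ξ, IsNonprincipalFilter (F ξ)) : IsNonprincipalFilter (⨆ ξ, F ξ) := by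
  obtain ⟨ξ⟩ := ‹Nonempty ι›
  exact ⟨(hF ξ).1.mono (le_iSup F ξ), iSup_le fun ξ => (hF ξ).2⟩

lemma le_symm_toUnit (t : Set.Ioc (0 : ℝ) (1 / 2)) : toUnit t ≤ unitInterval.symm (toUnit t) :=
  show (t : ℝ) ≤ 1 - t by linarith [t.2.2]

/-- In Mathlib's order on filters, `⨆ ξ, F ξ` is the intersection of the families `F ξ`:
a set belongs to it if and only if it belongs to every `F ξ`. -/
theorem theorem2p4 (hMA : MartinsAxiom)
    (p : ℕ → Set.Ioc (0 : ℝ) (1 / 2)) (hp : Tendsto (fun n => (p n : ℝ)) atTop (𝓝 0))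
    {ι : Type*} [Nonempty ι] (hι : Cardinal.mk ι < Cardinal.continuum)
    (F : ι → Filter ℕ) (hF : ∀ ξ, IsNonprincipalFilter (F ξ))
    (hFp : ∀ ξ, NonmeasurableFilter (muHat p) (F ξ)) :
    IsNonprincipalFilter (⨆ ξ, F ξ) ∧
      NonmeasurableFilter cantorLebesgue (⨆ ξ, F ξ) ∧
      ∀ q : ℕ → Set.Ioc (0 : ℝ) (1 / 2),
        Tendsto (fun n => (q n : ℝ) / (p n : ℝ)) atTop atTop →
          NonmeasurableFilter (muHat q) (⨆ ξ, F ξ) := by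
  have hnp := isNonprincipalFilter_iSup hF
  have hmain (q : ℕ → Set.Ioc (0 : ℝ) (1 / 2))
      (hpq : Tendsto (fun n => (q n : ℝ) / (p n : ℝ)) atTop atTop) :
      NonmeasurableFilter (muHat q) (⨆ ξ, F ξ) := by
    have hq₀ (n : ℕ) : toUnit (q n) ≠ 0 := unitInterval.coe_ne_zero.1 (q n).2.1.ne'
    have hq₁ (n : ℕ) : toUnit (q n) ≠ 1 :=
      unitInterval.coe_ne_one.1 ((q n).2.2.trans_lt one_half_lt_one).ne
    exact fun hmeas => hMA.bernoulliPi_charFunctions_iSup_ne_zero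
      (p := fun n => toUnit (p n)) hι hq₀ hq₁ hpq (fun ξ => (hF ξ).2)
      (fun ξ h₀ => hFp ξ (.of_null h₀))
      (bernoulliPi_charFunctions_eq_zero (fun n => le_symm_toUnit (q n)) hnp hmeas)
  refine ⟨hnp, hmain _ ?_, hmain⟩
  have hp' : Tendsto (fun n => (p n : ℝ)) atTop (𝓝[>] 0) :=
    tendsto_nhdsWithin_iff.2 ⟨hp, .of_forall fun n => (p n).2.1⟩
  exact (tendsto_inv_nhdsGT_zero.comp hp').const_mul_atTop one_half_pos
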